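/- **((m,m+2) MHMR outer bound.)** Let $m>1$. Consider a half-duplex network with nodes $r_0=a$, relays $r_1,\dots,r_m$, and $r_{m+1}=b$. Node $r_i$ has a finite nonempty input alphabet $\mathcal X_i$ and a finite output alphabet $\mathcal Y_i$, each enlarged by a dummy symbol $\varnothing$ meaning "no input" or "no output". The nodes are connected by a discrete memoryless channel $p(y_{r_0},\dots,y_{r_{m+1}}\mid x_{r_0},\dots,x_{r_{m+1}})$ in which a node with input $\ne\varnothing$ has output $\varnothing$. In the $(m,m+2)$ MHMR protocol every channel use belongs to one of $m+2$ phases, and in phase $m+2-i$ ($0\le i\le m+1$) node $r_i$ transmits a symbol of $\mathcal X_i$ while all other nodes have input $\varnothing$ and listen. Independent messages $W_a$ (known to $a$, wanted by $b$) and $W_b$ (known to $b$, wanted by $a$) are uniform on $\lfloor 2^{nR_a}\rfloor$ and $\lfloor 2^{nR_b}\rfloor$ values; the input of a node at time $k$ is a function of its own message (if any) and its outputs at times $1,\dots,k-1$, and $a$, $b$ decode from their own message and their $n$ outputs. Fix phase durations $\Delta_1,\dots,\Delta_{m+2}\ge 0$ with $\sum_\ell\Delta_\ell=1$. A pair $R_a,R_b\ge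 0$ is achievable if there are codes of block length $n=1,2,\dots$ whose fraction of channel uses in phase $\ell$ tends to $\Delta_\ell$ for every $\ell$ and whose two decoding error probabilities tend to $0$; the capacity region is the closure of the set of achievable pairs. Then for every $(R_a,R_b)$ in the capacity region there are input distributions $p^{(m+2-i)}(x_{r_i})$ on $\mathcal X_i$, $0\le i\le m+1$, such that $$R_a\le \min_{S_R\subseteq\{r_1,\dots,r_m\}}\ \sum_{r_i\in S_R\cup\{a\}}\Delta_{m+2-i}\, I\big(X_{r_i}^{(m+2-i)};Y_{\bar S_R}^{(m+2-i)},Y_b^{(m+2-i)}\big),$$ $$R_b\le \min_{S_R\subseteq\{r_1,\dots,r_m\}}\ \sum_{r_i\in S_R\cup\{b\}}\Delta_{m+2-i}\, I\big(X_{r_i}^{(m+2-i)};Y_{\bar S_R}^{(m+2-i)},Y_a^{(m+2-i)}\big),$$ where $\bar S_R=\{r_1,\dots,r_m\}\setminus S_R$, mutual information is in bits, and in phase $m+2-i$ the input $X_{r_i}^{(m+2-i)}$ has law $p^{(m+2-i)}$ and the outputs $Y^{(m+2-i)}$ are those of the channel when $r_i$ alone transmits $X_{r_i}^{(m+2-i)}$.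 The same input distributions serve both bounds and all sets $S_R$. -/

import Mathlib

open Filter Topology

noncomputable section

/-! Half-duplex bi-directional relay networks with nodes `r_0 = a, r_1, …, r_m, r_{m+1} = b`, indexed
by `Fin (m + 2)`. Node `i` has input alphabet `X i` and output alphabet `Y i`; `none` in
`Option (X i)`, `Option (Y i)` is the dummy symbol "no input" / "no output". -/

namespace HalfDuplexNetwork

/-- Mutual information, in bits, of a pair of random variables with joint probability mass
function `P` on a product of two finite sets (with the convention `0 log 0 = 0`). -/
def mutualInfo {α β : Type*} [Fintype α] [Fintype β] (P : α → β → ℝ) : ℝ :=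
  ∑ a, ∑ b, P a b * Real.logb 2 (P a b / ((∑ b', P a b') * ∑ a', P a' b))

/-- A discrete memoryless half-duplex channel: a probability mass function of the outputs of all
nodes given the inputs of all nodes; a node that transmits receives nothing. -/
structure Channel {m : ℕ} (X : Fin (m + 2) → Type*) (Y : Fin (m + 2) → Type*)
    [∀ i, Fintype (Y i)] where
  prob : (∀ i, Option (X i)) → (∀ i, Option (Y i)) → ℝ
  prob_mem : ∀ x, prob x ∈ stdSimplex ℝ (∀ i, Option (Y i))
  half_duplex : ∀ x y i, x i ≠ none → y i ≠ none → prob x y = 0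

/-- The messages available at node `i` when the messages are `w = (w_a, w_b)`: node `a = r_0` knows
`w_a`, node `b = r_{m+1}` knows `w_b`, and the relays know neither. -/
def localMessage {m M_a M_b : ℕ} (i : Fin (m + 2)) (w : Fin M_a × Fin M_b) :
    Option (Fin M_a) × Option (Fin M_b) :=
  (if i = 0 then some w.1 else none, if i = Fin.last (m + 1) then some w.2 else none)

/-- A code of block length `n` for the `(m, m+2)` MHMR protocol, with `M_a` messages at node `a` and
`M_b` messages at node `b`. The phases `1, …, m + 2` are indexed by `Fin (m + 2)` starting from `0`,
so that the phase `m + 2 - i` in which node `r_i` is the only transmitter has index `Fin.rev i`. -/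
structure Code {m : ℕ} (X : Fin (m + 2) → Type*) (Y : Fin (m + 2) → Type*)
    (n M_a M_b : ℕ) where
  /-- The phase to which each channel use belongs. -/
  phase : Fin n → Fin (m + 2)
  /-- The input of node `i` at time `k` as a function of its own messages and its past outputs. -/
  enc : (i : Fin (m + 2)) → (k : Fin n) → Option (Fin M_a) × Option (Fin M_b) →
    (Fin k → Option (Y i)) → Option (X i)
  /-- A node transmits exactly in its own phase. -/
  enc_ne_none_iff : ∀ i k u v, enc i k u v ≠ none ↔ phase k = Fin.rev i
  /-- The estimate of `w_a` at node `b`; `none` declares an error. -/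
  dec_b : Fin M_b → (Fin n → Option (Y (Fin.last (m + 1)))) → Option (Fin M_a)
  /-- The estimate of `w_b` at node `a`; `none` declares an error. -/
  dec_a : Fin M_a → (Fin n → Option (Y 0)) → Option (Fin M_b)

namespace Code

variable {m n M_a M_b : ℕ} {X : Fin (m + 2) → Type*} {Y : Fin (m + 2) → Type*}

/-- The inputs of all nodes at time `k`, given the messages and the outputs of all nodes. -/
def input (C : Code X Y n M_a M_b) (w : Fin M_a × Fin M_b) (y : Fin n → ∀ i, Option (Y i))
    (k : Fin n) (i : Fin (m + 2)) : Option (X i) :=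
  C.enc i k (localMessage i w) (fun j => y (Fin.castLE k.isLt.le j) i)

/-- The relative duration `n_ℓ / n` of phase `ℓ`. -/
def duration (C : Code X Y n M_a M_b) (ℓ : Fin (m + 2)) : ℝ :=
  ((Finset.univ.filter fun k => C.phase k = ℓ).card : ℝ) / n

variable [∀ i, Fintype (Y i)]

/-- The conditional probability of the output sequences `y` given the messages `w`, when the code
is used over the memoryless channel `W`. -/
def outputProb (C : Code X Y n M_a M_b) (W : Channel X Y) (w : Fin M_a × Fin M_b)
    (y : Fin n → ∀ i, Option (Y i)) : ℝ :=
  ∏ k, W.prob (C.input w y k) (y k)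

open Classical in
/-- The probability, under independent uniform messages, that node `b` does not recover `w_a`. -/
def errorProb_ab (C : Code X Y n M_a M_b) (W : Channel X Y) : ℝ :=
  (∑ w : Fin M_a × Fin M_b, ∑ y : Fin n → ∀ i, Option (Y i),
    if C.dec_b w.2 (fun k => y k (Fin.last (m + 1))) = some w.1 then 0
    else C.outputProb W w y) / (M_a * M_b)

open Classical in
/-- The probability, under independent uniform messages, that node `a` does not recover `w_b`. -/
def errorProb_ba (C : Code X Y n M_a M_b) (W : Channel X Y) : ℝ :=
  (∑ w : Fin M_a × Fin M_b, ∑ y : Fin n → ∀ i, Option (Y i),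
    if C.dec_a w.1 (fun k => y k 0) = some w.2 then 0
    else C.outputProb W w y) / (M_a * M_b)

end Code

namespace Channel

variable {m : ℕ} {X : Fin (m + 2) → Type*} {Y : Fin (m + 2) → Type*} [∀ i, Fintype (Y i)]

/-- The nonnegative rate pair `(R_a, R_b)` is achievable for the `(m, m+2)` MHMR protocol with phase
durations `Δ`: there are codes of all block lengths `n` with `⌊2 ^ (n R_a)⌋` and `⌊2 ^ (n R_b)⌋`
messages, whose relative durations tend to `Δ` and whose error probabilities tend to `0`. -/
def IsAchievable (W : Channel X Y) (Δ : Fin (m + 2) → ℝ) (R_a R_b : ℝ) : Prop :=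
  0 ≤ R_a ∧ 0 ≤ R_b ∧
    ∃ C : (n : ℕ) → Code X Y n ⌊(2 : ℝ) ^ (n * R_a)⌋₊ ⌊(2 : ℝ) ^ (n * R_b)⌋₊,
      (∀ ℓ, Tendsto (fun n => (C n).duration ℓ) atTop (𝓝 (Δ ℓ))) ∧
      Tendsto (fun n => (C n).errorProb_ab W) atTop (𝓝 0) ∧
      Tendsto (fun n => (C n).errorProb_ba W) atTop (𝓝 0)

/-- The capacity region of the `(m, m+2)` MHMR protocol with phase durations `Δ`. -/
def capacityRegion (W : Channel X Y) (Δ : Fin (m + 2) → ℝ) : Set (ℝ × ℝ) :=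
  closure {R | W.IsAchievable Δ R.1 R.2}

/-- The inputs of all nodes when node `i` transmits `x` and all others are silent. -/
def onlyInput (i : Fin (m + 2)) (x : X i) : ∀ j, Option (X j) :=
  Function.update (fun _ => none) i (some x)

open Classical in
/-- The probability that the nodes in `T` receive `z` when node `i` transmits `x` and all others
are silent. -/
def phaseProb (W : Channel X Y) (i : Fin (m + 2)) (T : Finset (Fin (m + 2))) (x : X i)
    (z : ∀ j : T, Option (Y j)) : ℝ :=
  ∑ y : ∀ j, Option (Y j), if T.restrict y = z then W.prob (onlyInput i x) y else 0

/-- The mutual information `I(X_{r_i}; Y_T)` in the phase in which only `r_i` transmits, with input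
distribution `p`. -/
def phaseInfo (W : Channel X Y) (i : Fin (m + 2)) [Fintype (X i)] (T : Finset (Fin (m + 2)))
    (p : X i → ℝ) : ℝ :=
  mutualInfo fun (x : X i) (z : ∀ j : T, Option (Y j)) => p x * W.phaseProb i T x z

end Channel

/-- The set of relays `r_1, …, r_m`. -/
def relays (m : ℕ) : Finset (Fin (m + 2)) := {0, Fin.last (m + 1)}ᶜ

end HalfDuplexNetwork

end

/-! The proof is a cut-set converse by change of measure, with no conditional entropies and no Fano
inequality. Fix a set `T` of receiving nodes that contains the destination but not the source.
Whenever the transmitter lies outside `T`, multiply the channel law by `cutRatio`, the quotient of a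
fixed reference law of the outputs in `T` by their actual law. After this tilting the outputs in `T`
are dominated by a process, `cutProb`, driven only by what nodes of `T` know, so a decoder in `T`
can only guess the message (`sum_seqProb_tiltedProb_success_le`). Gibbs' inequality compares this
with the true law: log of the number of messages, times the success probability, is at most minus
the expected log of the total ratio, plus `log 2`. If the reference law is the output law of the
phase-averaged input, that expected log is exactly minus the sum of phase lengths times mutual
informations (`sum_expect_log_stepRatio`). The averaged inputs do not depend on `T`, so one choice
serves every cut and both directions. It remains to divide by the block length and let it grow. The
input simplices are compact and mutual information is continuous on them, so the region of rates and
durations obeying all the bounds is closed (`Channel.isClosed_outerRegion`). This handles both the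
limit and the closure defining the capacity region. -/

noncomputable section

namespace HalfDuplexNetwork

/-! ### Laws of sequences generated by history-dependent kernels -/

section SequentialSums

/-- The first `k` entries of a sequence of length `n`. -/
def prefixOf {A : Type*} {n : ℕ} (y : Fin n → A) (k : Fin n) : Fin k → A :=
  fun j => y (Fin.castLE k.isLt.le j)

/-- The product of the one-step kernels `K` along a sequence. -/
def seqProb {A : Type*} {n : ℕ} (K : (k : Fin n) → (Fin k → A) → A → ℝ) (y : Fin n → A) : ℝ :=
  ∏ k, K k (prefixOf y k) (y k)

variable {A Z : Type*} {n : ℕ}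

lemma seqProb_nonneg {K : (k : Fin n) → (Fin k → A) → A → ℝ} (hK : ∀ k v a, 0 ≤ K k v a)
    (y : Fin n → A) : 0 ≤ seqProb K y :=
  Finset.prod_nonneg fun _ _ => hK _ _ _

lemma prefixOf_snoc_castSucc (y : Fin n → A) (a : A) (k : Fin n) :
    prefixOf (Fin.snoc y a : Fin (n + 1) → A) k.castSucc = prefixOf y k := by
  funext j
  exact Fin.snoc_castSucc (α := fun _ => A) a y (Fin.castLE k.isLt.le j)

lemma prefixOf_snoc_last (y : Fin n → A) (a : A) :
    prefixOf (Fin.snoc y a : Fin (n + 1) → A) (Fin.last n) = y := by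
  funext j
  exact Fin.snoc_castSucc (α := fun _ => A) a y j

lemma seqProb_snoc (K : (k : Fin (n + 1)) → (Fin k → A) → A → ℝ) (y : Fin n → A) (a : A) :
    seqProb K (Fin.snoc y a : Fin (n + 1) → A) =
      seqProb (fun k => K k.castSucc) y * K (Fin.last n) y a := by
  unfold seqProb
  rw [Fin.prod_univ_castSucc]
  congr 1
  · refine Finset.prod_congr rfl fun k _ => ?_
    rw [prefixOf_snoc_castSucc, Fin.snoc_castSucc]
  · rw [prefixOf_snoc_last, Fin.snoc_last]

lemma sum_snoc [Fintype A] (F : (Fin (n + 1) → A) → ℝ) :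
    ∑ y, F y = ∑ y : Fin n → A, ∑ a, F (Fin.snoc y a : Fin (n + 1) → A) := by
  rw [← (Fin.snocEquiv fun _ : Fin (n + 1) => A).sum_comp, Fintype.sum_prod_type_right]
  rfl

open Classical in
lemma sum_mul_comp_eq [Fintype A] [Fintype Z] (π : A → Z) (f : A → ℝ) (g : Z → ℝ) :
    ∑ a, f a * g (π a) = ∑ z, (∑ a, if π a = z then f a else 0) * g z := by
  simp_rw [Finset.sum_mul]
  rw [Finset.sum_comm]
  refine Finset.sum_congr rfl fun a _ => ?_
  simp [ite_mul]

open Classical in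
/-- If every one-step kernel `K` pushed forward along `π` is dominated by `G`, then so is the law of
the whole sequence. -/
lemma sum_seqProb_comp_le [Fintype A] [Fintype Z] (π : A → Z)
    (K : (k : Fin n) → (Fin k → A) → A → ℝ) (G : (k : Fin n) → (Fin k → Z) → Z → ℝ)
    (hK : ∀ k v a, 0 ≤ K k v a) (hG : ∀ k v z, 0 ≤ G k v z)
    (hKG : ∀ k v z, (∑ a, if π a = z then K k v a else 0) ≤ G k (π ∘ v) z)
    (g : (Fin n → Z) → ℝ) (hg : ∀ z, 0 ≤ g z) :
    ∑ y, seqProb K y * g (π ∘ y) ≤ ∑ z, seqProb G z * g z := by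
  induction n with
  | zero => simp [seqProb, Subsingleton.elim (π ∘ (default : Fin 0 → A)) default]
  | succ n ih =>
    rw [sum_snoc, sum_snoc]
    simp_rw [seqProb_snoc, mul_assoc, ← Finset.mul_sum]
    have hcomp : ∀ (y : Fin n → A) (a : A),
        π ∘ (Fin.snoc y a : Fin (n + 1) → A) = (Fin.snoc (π ∘ y) (π a) : Fin (n + 1) → Z) :=
      fun y a => Fin.comp_snoc π y a
    simp_rw [hcomp]
    -- The induction hypothesis is applied to `g` with its last coordinate integrated out against
    -- `G`.
    refine le_trans ?_ (ih (fun k => K k.castSucc)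
      (fun k => G k.castSucc) (fun k => hK k.castSucc) (fun k => hG k.castSucc)
      (fun k => hKG k.castSucc)
      (fun z => ∑ c, G (Fin.last n) z c * g (Fin.snoc z c : Fin (n + 1) → Z))
      fun z => Finset.sum_nonneg fun c _ => mul_nonneg (hG _ _ _) (hg _))
    refine Finset.sum_le_sum fun y _ => ?_
    refine mul_le_mul_of_nonneg_left ?_ (seqProb_nonneg (fun k => hK k.castSucc) y)
    rw [sum_mul_comp_eq π (K (Fin.last n) y)
      (fun c => g (Fin.snoc (π ∘ y) c : Fin (n + 1) → Z))]
    exact Finset.sum_le_sum fun c _ => mul_le_mul_of_nonneg_right (hKG (Fin.last n) y c) (hg _)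

/-- Tower property: coordinates after `k` integrate to one, and coordinate `k` is averaged by its
kernel given the past. -/
lemma sum_seqProb_mul_step [Fintype A] (K : (k : Fin n) → (Fin k → A) → A → ℝ)
    (hK1 : ∀ k v, ∑ a, K k v a = 1) (k : Fin n) (h : (Fin k → A) → A → ℝ) :
    ∑ y, seqProb K y * h (prefixOf y k) (y k) =
      ∑ y, seqProb K y * ∑ a, K k (prefixOf y k) a * h (prefixOf y k) a := by
  induction n with
  | zero => exact k.elim0
  | succ n ih =>
    simp_rw [sum_snoc, seqProb_snoc, mul_assoc, ← Finset.mul_sum]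
    refine Fin.lastCases (fun h => ?_) (fun k h => ?_) k h
    · simp_rw [prefixOf_snoc_last, Fin.snoc_last, ← Finset.sum_mul, hK1, one_mul]
    · simp_rw [prefixOf_snoc_castSucc, Fin.snoc_castSucc, ← Finset.sum_mul, hK1, one_mul]
      exact ih (fun k => K k.castSucc) (fun k => hK1 k.castSucc) k h

lemma sum_seqProb_eq_one [Fintype A] (K : (k : Fin n) → (Fin k → A) → A → ℝ)
    (hK1 : ∀ k v, ∑ a, K k v a = 1) : ∑ y, seqProb K y = 1 := by
  induction n with
  | zero => simp [seqProb]
  | succ n ih =>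
    simp_rw [sum_snoc, seqProb_snoc, ← Finset.mul_sum, hK1, mul_one]
    exact ih _ fun k => hK1 k.castSucc

/-- A form of Gibbs' inequality. -/
lemma sum_mul_log_nonpos {Ω : Type*} [Fintype Ω] (P R : Ω → ℝ) (hP : ∀ ω, 0 ≤ P ω)
    (hP1 : ∑ ω, P ω = 1) (hR : ∀ ω, 0 < P ω → 0 < R ω) (hPR : ∑ ω, P ω * R ω ≤ 1) :
    ∑ ω, P ω * Real.log (R ω) ≤ 0 := by
  have h : ∀ ω, P ω * Real.log (R ω) ≤ P ω * R ω - P ω := fun ω => by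
    rcases (hP ω).eq_or_lt with h0 | h0
    · simp [← h0]
    · have := mul_le_mul_of_nonneg_left (Real.log_le_sub_one_of_pos (hR ω h0)) h0.le
      linarith
  calc _ ≤ ∑ ω, (P ω * R ω - P ω) := Finset.sum_le_sum fun ω _ => h ω
    _ ≤ 0 := by rw [Finset.sum_sub_distrib, hP1]; linarith

end SequentialSums

/-! ### Mutual information: continuity and divergence form -/

section MutualInformation

variable {α β : Type*} [Fintype α] [Fintype β]

/-- The entropy form gives continuity up to the boundary, where the quotient inside the logarithm is
singular but `negMulLog` is continuous. -/
lemma mutualInfo_eq_negMulLog {P : α → β → ℝ} (hP : ∀ a b, 0 ≤ P a b) :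
    mutualInfo P = (∑ a, Real.negMulLog (∑ b, P a b) + ∑ b, Real.negMulLog (∑ a, P a b) -
      ∑ a, ∑ b, Real.negMulLog (P a b)) / Real.log 2 := by
  have h1 : ∑ a, Real.negMulLog (∑ b, P a b) =
      ∑ a, ∑ b, -(P a b * Real.log (∑ b', P a b')) := by
    simp [Real.negMulLog, Finset.sum_mul]
  have h2 : ∑ b, Real.negMulLog (∑ a, P a b) =
      ∑ a, ∑ b, -(P a b * Real.log (∑ a', P a' b)) := by
    rw [Finset.sum_comm]
    simp [Real.negMulLog, Finset.sum_mul]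
  rw [mutualInfo, h1, h2, ← Finset.sum_add_distrib, ← Finset.sum_sub_distrib, Finset.sum_div]
  refine Finset.sum_congr rfl fun a _ => ?_
  rw [← Finset.sum_add_distrib, ← Finset.sum_sub_distrib, Finset.sum_div]
  refine Finset.sum_congr rfl fun b _ => ?_
  rcases (hP a b).eq_or_lt with h0 | h0
  · simp [← h0]
  · have hr : 0 < ∑ b', P a b' :=
      h0.trans_le (Finset.single_le_sum (fun b' _ => hP a b') (Finset.mem_univ b))
    have hc : 0 < ∑ a', P a' b :=
      h0.trans_le (Finset.single_le_sum (f := fun a' => P a' b) (fun a' _ => hP a' b)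
        (Finset.mem_univ a))
    rw [Real.logb, Real.log_div h0.ne' (mul_pos hr hc).ne', Real.log_mul hr.ne' hc.ne',
      Real.negMulLog]
    ring

lemma continuousOn_mutualInfo :
    ContinuousOn (mutualInfo : (α → β → ℝ) → ℝ) {P | ∀ a b, 0 ≤ P a b} := by
  refine ContinuousOn.congr (Continuous.continuousOn ?_) fun P hP => mutualInfo_eq_negMulLog hP
  fun_prop

lemma mutualInfo_mul_log_two (p : α → ℝ) (V : α → β → ℝ) (hV1 : ∀ a, ∑ b, V a b = 1) :
    mutualInfo (fun a b => p a * V a b) * Real.log 2 =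
      ∑ a, p a * ∑ b, V a b * Real.log (V a b / ∑ a', p a' * V a' b) := by
  have h2 : Real.log 2 ≠ 0 := (Real.log_pos one_lt_two).ne'
  have hr : ∀ a, ∑ b, p a * V a b = p a := fun a => by rw [← Finset.mul_sum, hV1, mul_one]
  simp only [mutualInfo, Real.logb, hr, Finset.sum_mul]
  refine Finset.sum_congr rfl fun a _ => ?_
  rw [Finset.mul_sum]
  refine Finset.sum_congr rfl fun b _ => ?_
  rcases eq_or_ne (p a) 0 with h0 | h0
  · simp [h0]
  · rw [mul_div_mul_left _ _ h0]
    field_simp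

end MutualInformation

section

variable {m : ℕ} {X : Fin (m + 2) → Type*} {Y : Fin (m + 2) → Type*}

/-! ### Output laws of a single phase and the tilting ratio -/

namespace Channel

variable [∀ i, Fintype (Y i)]

open Classical in
/-- The law of the outputs of the nodes in `T` when the inputs of all nodes are `u`. -/
def marginal (W : Channel X Y) (T : Finset (Fin (m + 2))) (u : ∀ i, Option (X i))
    (z : ∀ j : T, Option (Y j)) : ℝ :=
  ∑ y : ∀ j, Option (Y j), if T.restrict y = z then W.prob u y else 0

variable (W : Channel X Y) (T : Finset (Fin (m + 2)))

lemma prob_nonneg (u : ∀ i, Option (X i)) (y : ∀ i, Option (Y i)) : 0 ≤ W.prob u y :=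
  (W.prob_mem u).1 y

lemma sum_prob (u : ∀ i, Option (X i)) : ∑ y, W.prob u y = 1 := (W.prob_mem u).2

lemma phaseProb_eq_marginal (i : Fin (m + 2)) (x : X i) :
    W.phaseProb i T x = W.marginal T (onlyInput i x) := rfl

lemma sum_prob_mul_restrict (u : ∀ i, Option (X i)) (g : (∀ j : T, Option (Y j)) → ℝ) :
    ∑ y, W.prob u y * g (T.restrict y) = ∑ z, W.marginal T u z * g z := by
  have h := sum_mul_comp_eq T.restrict (W.prob u) g
  unfold marginal
  convert h

lemma marginal_nonneg (u : ∀ i, Option (X i)) (z : ∀ j : T, Option (Y j)) :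
    0 ≤ W.marginal T u z :=
  Finset.sum_nonneg fun y _ => by split_ifs; exacts [W.prob_nonneg u y, le_rfl]

lemma sum_marginal (u : ∀ i, Option (X i)) : ∑ z, W.marginal T u z = 1 := by
  have h := W.sum_prob_mul_restrict T u fun _ => 1
  simpa [W.sum_prob] using h.symm

lemma prob_le_marginal (u : ∀ i, Option (X i)) (y : ∀ i, Option (Y i)) :
    W.prob u y ≤ W.marginal T u (T.restrict y) := by
  classical
  refine le_trans (by simp) (Finset.single_le_sum (fun y' _ => ?_) (Finset.mem_univ y))
  split_ifs
  exacts [W.prob_nonneg u y', le_rfl]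

/-- The law of the outputs of the nodes in `T` when only node `i` transmits, with input
distribution `p`. -/
def outputLaw (i : Fin (m + 2)) [Fintype (X i)] (p : X i → ℝ) (z : ∀ j : T, Option (Y j)) : ℝ :=
  ∑ x, p x * W.phaseProb i T x z

lemma outputLaw_nonneg (i : Fin (m + 2)) [Fintype (X i)] {p : X i → ℝ}
    (hp : p ∈ stdSimplex ℝ (X i)) (z : ∀ j : T, Option (Y j)) : 0 ≤ W.outputLaw T i p z :=
  Finset.sum_nonneg fun x _ => mul_nonneg (hp.1 x) (W.marginal_nonneg T _ z)

lemma sum_outputLaw (i : Fin (m + 2)) [Fintype (X i)] {p : X i → ℝ}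
    (hp : p ∈ stdSimplex ℝ (X i)) : ∑ z, W.outputLaw T i p z = 1 := by
  simp_rw [outputLaw]
  rw [Finset.sum_comm]
  simp_rw [← Finset.mul_sum, phaseProb_eq_marginal, W.sum_marginal, mul_one, hp.2]

lemma phaseInfo_mul_log_two (i : Fin (m + 2)) [Fintype (X i)] (p : X i → ℝ) :
    W.phaseInfo i T p * Real.log 2 = ∑ x, p x * ∑ z, W.phaseProb i T x z *
      Real.log (W.phaseProb i T x z / W.outputLaw T i p z) :=
  mutualInfo_mul_log_two p (W.phaseProb i T) fun x => W.sum_marginal T (onlyInput i x)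

/-- The factor by which the law of the outputs in `T` is changed in the phase of node `i` to make
them independent of the input if `i ∉ T`. -/
def cutRatio (i : Fin (m + 2)) [Fintype (X i)] (p : X i → ℝ) (u : ∀ i, Option (X i))
    (z : ∀ j : T, Option (Y j)) : ℝ :=
  if i ∈ T then 1 else W.outputLaw T i p z / W.marginal T u z

lemma cutRatio_nonneg (i : Fin (m + 2)) [Fintype (X i)] {p : X i → ℝ}
    (hp : p ∈ stdSimplex ℝ (X i)) (u : ∀ i, Option (X i)) (z : ∀ j : T, Option (Y j)) :
    0 ≤ W.cutRatio T i p u z := by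
  unfold cutRatio
  split_ifs
  exacts [zero_le_one, div_nonneg (W.outputLaw_nonneg T i hp z) (W.marginal_nonneg T u z)]

/-- Outside `T` the ratio is the inverse of the likelihood ratio whose mean logarithm is the mutual
information. -/
lemma sum_marginal_mul_log_cutRatio (i : Fin (m + 2)) [Fintype (X i)] (p : X i → ℝ) :
    ∑ x, p x * ∑ z, W.marginal T (onlyInput i x) z *
        Real.log (W.cutRatio T i p (onlyInput i x) z) =
      if i ∈ T then 0 else -(W.phaseInfo i T p * Real.log 2) := by
  unfold cutRatio
  split_ifs with hi
  · simp
  · rw [phaseInfo_mul_log_two, ← Finset.sum_neg_distrib]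
    refine Finset.sum_congr rfl fun x _ => ?_
    rw [← mul_neg, ← Finset.sum_neg_distrib]
    congr 1
    refine Finset.sum_congr rfl fun z _ => ?_
    rw [phaseProb_eq_marginal, ← mul_neg, ← Real.log_inv, inv_div]

end Channel

/-! ### Inputs produced by a code and their phase averages -/

namespace Code

variable {n M_a M_b : ℕ} (C : Code X Y n M_a M_b)

/-- The inputs of all nodes at time `k`, given the messages and the past outputs. -/
def stepInput (w : Fin M_a × Fin M_b) (k : Fin n) (v : Fin k → ∀ i, Option (Y i))
    (i : Fin (m + 2)) : Option (X i) :=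
  C.enc i k (localMessage i w) fun j => v j i

lemma input_eq_stepInput (w : Fin M_a × Fin M_b) (y : Fin n → ∀ i, Option (Y i)) (k : Fin n) :
    C.input w y k = C.stepInput w k (prefixOf y k) := rfl

/-- The node that transmits at time `k`. -/
def sender (k : Fin n) : Fin (m + 2) := Fin.rev (C.phase k)

lemma sender_eq_iff {k : Fin n} {i : Fin (m + 2)} : C.sender k = i ↔ C.phase k = Fin.rev i := by
  rw [sender, Fin.rev_eq_iff]

lemma enc_sender_ne_none (k : Fin n) (s : Option (Fin M_a) × Option (Fin M_b))
    (v : Fin k → Option (Y (C.sender k))) : C.enc (C.sender k) k s v ≠ none :=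
  (C.enc_ne_none_iff _ _ _ _).2 (C.sender_eq_iff.1 rfl)

/-- Only one node speaks, so the whole input vector depends on the messages and the past through the
sender alone. If the sender is in `T`, knowledge inside `T` determines it. -/
lemma stepInput_eq_update (w : Fin M_a × Fin M_b) (k : Fin n) (v : Fin k → ∀ i, Option (Y i)) :
    C.stepInput w k v = Function.update (fun _ => none) (C.sender k)
      (C.enc (C.sender k) k (localMessage (C.sender k) w) fun j => v j (C.sender k)) := by
  funext i
  by_cases h : i = C.sender k
  · subst h
    simp [stepInput]
  · rw [Function.update_of_ne h]
    by_contra hne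
    exact h (C.sender_eq_iff.2 ((C.enc_ne_none_iff _ _ _ _).1 hne)).symm

lemma stepInput_eq_onlyInput (w : Fin M_a × Fin M_b) (k : Fin n)
    (v : Fin k → ∀ i, Option (Y i)) :
    ∃ x, C.stepInput w k v (C.sender k) = some x ∧
      C.stepInput w k v = Channel.onlyInput (C.sender k) x := by
  obtain ⟨x, hx⟩ := Option.ne_none_iff_exists'.1 (C.enc_sender_ne_none k
    (localMessage (C.sender k) w) fun j => v j (C.sender k))
  refine ⟨x, hx, ?_⟩
  rw [stepInput_eq_update, hx]
  rfl

variable [∀ i, Fintype (Y i)] (W : Channel X Y)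

/-- The conditional law of the outputs at time `k` given the messages and the past outputs. -/
def stepProb (w : Fin M_a × Fin M_b) (k : Fin n) (v : Fin k → ∀ i, Option (Y i))
    (a : ∀ i, Option (Y i)) : ℝ :=
  W.prob (C.stepInput w k v) a

lemma outputProb_nonneg (w : Fin M_a × Fin M_b) (y : Fin n → ∀ i, Option (Y i)) :
    0 ≤ C.outputProb W w y :=
  Finset.prod_nonneg fun _ _ => W.prob_nonneg _ _

lemma sum_outputProb (w : Fin M_a × Fin M_b) : ∑ y, C.outputProb W w y = 1 :=
  sum_seqProb_eq_one (C.stepProb W w) fun _ _ => W.sum_prob _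

/-- The expectation of a function of the messages and the outputs, under independent uniform
messages. -/
def expect (f : Fin M_a × Fin M_b → (Fin n → ∀ i, Option (Y i)) → ℝ) : ℝ :=
  (∑ w, ∑ y, C.outputProb W w y * f w y) / (M_a * M_b)

lemma expect_sum {ι : Type*} (s : Finset ι)
    (f : ι → Fin M_a × Fin M_b → (Fin n → ∀ i, Option (Y i)) → ℝ) :
    C.expect W (fun w y => ∑ j ∈ s, f j w y) = ∑ j ∈ s, C.expect W (f j) := by
  simp only [expect, ← Finset.sum_div, Finset.mul_sum]
  congr 1
  symm
  rw [Finset.sum_comm]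
  refine Finset.sum_congr rfl fun w _ => Finset.sum_comm

lemma expect_mul_const (f : Fin M_a × Fin M_b → (Fin n → ∀ i, Option (Y i)) → ℝ) (c : ℝ) :
    C.expect W (fun w y => f w y * c) = C.expect W f * c := by
  simp only [expect, ← mul_assoc, ← Finset.sum_mul]
  ring

lemma expect_nonneg {f : Fin M_a × Fin M_b → (Fin n → ∀ i, Option (Y i)) → ℝ}
    (hf : ∀ w y, 0 ≤ f w y) : 0 ≤ C.expect W f :=
  div_nonneg (Finset.sum_nonneg fun w _ => Finset.sum_nonneg fun y _ =>
    mul_nonneg (C.outputProb_nonneg W w y) (hf w y)) (by positivity)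

lemma expect_one [NeZero M_a] [NeZero M_b] : C.expect W (fun _ _ => 1) = 1 := by
  have ha : (M_a : ℝ) ≠ 0 := NeZero.ne _
  have hb : (M_b : ℝ) ≠ 0 := NeZero.ne _
  simp only [expect, mul_one, sum_outputProb, Finset.sum_const, Finset.card_univ,
    Fintype.card_prod, Fintype.card_fin, nsmul_eq_mul]
  push_cast
  exact div_self (mul_ne_zero ha hb)

open Classical in
/-- The law of the input of node `i` at time `k`, under independent uniform messages. -/
def inputProb (k : Fin n) (i : Fin (m + 2)) (x : X i) : ℝ :=
  C.expect W fun w y => if C.input w y k i = some x then 1 else 0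

lemma inputProb_nonneg (k : Fin n) (i : Fin (m + 2)) (x : X i) : 0 ≤ C.inputProb W k i x :=
  C.expect_nonneg W fun w y => by split_ifs; exacts [zero_le_one, le_rfl]

lemma inputProb_pos [NeZero M_a] [NeZero M_b] {w : Fin M_a × Fin M_b}
    {y : Fin n → ∀ i, Option (Y i)} (hwy : 0 < C.outputProb W w y) {k : Fin n}
    {i : Fin (m + 2)} {x : X i} (hx : C.input w y k i = some x) : 0 < C.inputProb W k i x := by
  classical
  have ha : (0 : ℝ) < M_a := Nat.cast_pos.2 (NeZero.pos _)
  have hb : (0 : ℝ) < M_b := Nat.cast_pos.2 (NeZero.pos _)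
  have h0 : ∀ w' y', 0 ≤ C.outputProb W w' y' * (if C.input w' y' k i = some x then 1 else 0) :=
    fun w' y' => mul_nonneg (C.outputProb_nonneg W w' y') (by split_ifs <;> simp)
  refine div_pos (Finset.sum_pos' (fun w' _ => Finset.sum_nonneg fun y' _ => h0 w' y')
    ⟨w, Finset.mem_univ _, Finset.sum_pos' (fun y' _ => h0 w y') ⟨y, Finset.mem_univ _, ?_⟩⟩)
    (mul_pos ha hb)
  simpa [hx] using hwy

lemma expect_input [∀ i, Fintype (X i)] (k : Fin n) (F : (∀ i, Option (X i)) → ℝ) :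
    C.expect W (fun w y => F (C.input w y k)) =
      ∑ x, C.inputProb W k (C.sender k) x * F (Channel.onlyInput (C.sender k) x) := by
  classical
  simp_rw [inputProb, ← expect_mul_const, ← expect_sum]
  congr 1
  funext w y
  obtain ⟨x, hx, hu⟩ := C.stepInput_eq_onlyInput w k (prefixOf y k)
  simp [input_eq_stepInput, hx, hu]

lemma sum_inputProb [∀ i, Fintype (X i)] [NeZero M_a] [NeZero M_b] (k : Fin n) :
    ∑ x, C.inputProb W k (C.sender k) x = 1 := by
  rw [← C.expect_one W, C.expect_input W k fun _ => 1]
  simp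

variable [∀ i, Nonempty (X i)]

open Classical in
/-- The law of the input of node `i` averaged over the channel uses in its phase. -/
def phaseInput (i : Fin (m + 2)) : X i → ℝ :=
  -- An empty phase receives an arbitrary point mass, so that the value is still a distribution; it
  -- enters the bounds with weight zero.
  if (Finset.univ.filter fun k => C.phase k = Fin.rev i) = ∅ then Pi.single (Classical.arbitrary _) 1
  else fun x => (∑ k with C.phase k = Fin.rev i, C.inputProb W k i x) /
    (Finset.univ.filter fun k => C.phase k = Fin.rev i).card

/-- Stated without division so that empty phases are included. -/
lemma sum_inputProb_eq (i : Fin (m + 2)) (x : X i) :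
    ∑ k with C.phase k = Fin.rev i, C.inputProb W k i x =
      (Finset.univ.filter fun k => C.phase k = Fin.rev i).card * C.phaseInput W i x := by
  unfold phaseInput
  split_ifs with h
  · simp [h]
  · have : ((Finset.univ.filter fun k => C.phase k = Fin.rev i).card : ℝ) ≠ 0 :=
      Nat.cast_ne_zero.2 (Finset.card_ne_zero.2 (Finset.nonempty_iff_ne_empty.2 h))
    field_simp

lemma phaseInput_pos_of_input [NeZero M_a] [NeZero M_b] {w : Fin M_a × Fin M_b}
    {y : Fin n → ∀ i, Option (Y i)} (hwy : 0 < C.outputProb W w y) {k : Fin n}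
    {x : X (C.sender k)} (hx : C.input w y k (C.sender k) = some x) :
    0 < C.phaseInput W (C.sender k) x := by
  have h1 := C.inputProb_pos W hwy hx
  have h2 : C.inputProb W k (C.sender k) x ≤
      ∑ k' with C.phase k' = Fin.rev (C.sender k), C.inputProb W k' (C.sender k) x :=
    Finset.single_le_sum (f := fun k' => C.inputProb W k' (C.sender k) x)
      (fun k' _ => C.inputProb_nonneg W k' _ x)
      (Finset.mem_filter.2 ⟨Finset.mem_univ _, C.sender_eq_iff.1 rfl⟩)
  rw [sum_inputProb_eq] at h2
  exact pos_of_mul_pos_right (h1.trans_le h2) (Nat.cast_nonneg _)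

variable [∀ i, Fintype (X i)]

lemma phaseInput_mem [NeZero M_a] [NeZero M_b] (i : Fin (m + 2)) :
    C.phaseInput W i ∈ stdSimplex ℝ (X i) := by
  classical
  by_cases h : (Finset.univ.filter fun k => C.phase k = Fin.rev i) = ∅
  · rw [phaseInput, if_pos h]
    exact single_mem_stdSimplex ℝ _
  · have hc : ((Finset.univ.filter fun k => C.phase k = Fin.rev i).card : ℝ) ≠ 0 :=
      Nat.cast_ne_zero.2 (Finset.card_ne_zero.2 (Finset.nonempty_iff_ne_empty.2 h))
    rw [phaseInput, if_neg h]
    refine ⟨fun x => div_nonneg (Finset.sum_nonneg fun k _ => C.inputProb_nonneg W k i x)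
      (Nat.cast_nonneg _), ?_⟩
    rw [← Finset.sum_div, Finset.sum_comm, div_eq_one_iff_eq hc, Finset.cast_card]
    refine Finset.sum_congr rfl fun k hk => ?_
    obtain rfl := C.sender_eq_iff.2 (Finset.mem_filter.1 hk).2
    exact C.sum_inputProb W k

/-! ### Tilting the law of the code along a cut -/

variable (T : Finset (Fin (m + 2)))

/-- The factor `Channel.cutRatio` at time `k`, with the averaged input law of the sender. -/
def stepRatio (k : Fin n) (u : ∀ i, Option (X i)) (z : ∀ j : T, Option (Y j)) : ℝ :=
  W.cutRatio T (C.sender k) (C.phaseInput W (C.sender k)) u z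

/-- The averaged input charges every symbol actually sent, so the reference law charges every output
that occurs. Hence logarithms of the ratios split on the support of the true law. -/
lemma stepRatio_pos [NeZero M_a] [NeZero M_b] {w : Fin M_a × Fin M_b}
    {y : Fin n → ∀ i, Option (Y i)} (hwy : 0 < C.outputProb W w y) (k : Fin n) :
    0 < C.stepRatio W T k (C.input w y k) (T.restrict (y k)) := by
  unfold stepRatio Channel.cutRatio
  split_ifs with h
  · exact zero_lt_one
  have hk : 0 < W.prob (C.input w y k) (y k) :=
    (W.prob_nonneg _ _).lt_of_ne' fun h0 =>
      hwy.ne' (Finset.prod_eq_zero (Finset.mem_univ k) h0)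
  have hm := hk.trans_le (W.prob_le_marginal T _ _)
  refine div_pos ?_ hm
  obtain ⟨x, hx, hu⟩ := C.stepInput_eq_onlyInput w k (prefixOf y k)
  rw [← input_eq_stepInput] at hx hu
  have hp := C.phaseInput_mem W (C.sender k)
  rw [hu] at hm
  refine Finset.sum_pos' (fun x' _ => mul_nonneg (hp.1 x') (W.marginal_nonneg T _ _))
    ⟨x, Finset.mem_univ _, mul_pos (C.phaseInput_pos_of_input W hwy hx) hm⟩

lemma expect_log_stepRatio (k : Fin n) :
    C.expect W (fun w y => Real.log (C.stepRatio W T k (C.input w y k) (T.restrict (y k)))) =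
      ∑ x, C.inputProb W k (C.sender k) x *
        ∑ z, W.marginal T (Channel.onlyInput (C.sender k) x) z *
          Real.log (C.stepRatio W T k (Channel.onlyInput (C.sender k) x) z) := by
  rw [← C.expect_input W k fun u => ∑ z, W.marginal T u z * Real.log (C.stepRatio W T k u z)]
  unfold expect
  congr 1
  refine Finset.sum_congr rfl fun w _ => ?_
  simp_rw [← Channel.sum_prob_mul_restrict]
  exact sum_seqProb_mul_step (C.stepProb W w) (fun _ _ => W.sum_prob _) k fun v a =>
    Real.log (C.stepRatio W T k (C.stepInput w k v) (T.restrict a))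

/-- The reference law is constant within a phase, so the expected log-ratio is linear in the input
law at each time. Summing over the phase gives the averaged input exactly, with no appeal to
concavity. -/
lemma sum_expect_log_stepRatio :
    ∑ k, C.expect W (fun w y =>
        Real.log (C.stepRatio W T k (C.input w y k) (T.restrict (y k)))) =
      -∑ i ∈ Tᶜ, (Finset.univ.filter fun k => C.phase k = Fin.rev i).card *
        (W.phaseInfo i T (C.phaseInput W i) * Real.log 2) := by
  have hfib : ∀ i, ∑ k with C.phase k = Fin.rev i, C.expect W (fun w y =>
        Real.log (C.stepRatio W T k (C.input w y k) (T.restrict (y k)))) =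
      if i ∈ T then 0 else -((Finset.univ.filter fun k => C.phase k = Fin.rev i).card *
        (W.phaseInfo i T (C.phaseInput W i) * Real.log 2)) := by
    intro i
    have h1 : ∀ k ∈ Finset.univ.filter fun k => C.phase k = Fin.rev i, C.expect W (fun w y =>
          Real.log (C.stepRatio W T k (C.input w y k) (T.restrict (y k)))) =
        ∑ x, C.inputProb W k i x * ∑ z, W.marginal T (Channel.onlyInput i x) z *
          Real.log (W.cutRatio T i (C.phaseInput W i) (Channel.onlyInput i x) z) := by
      intro k hk
      obtain rfl := C.sender_eq_iff.2 (Finset.mem_filter.1 hk).2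
      exact C.expect_log_stepRatio W T k
    rw [Finset.sum_congr rfl h1, Finset.sum_comm]
    simp_rw [← Finset.sum_mul, C.sum_inputProb_eq, mul_assoc, ← Finset.mul_sum]
    rw [W.sum_marginal_mul_log_cutRatio]
    split_ifs <;> simp
  rw [← Finset.sum_fiberwise Finset.univ C.sender]
  simp_rw [C.sender_eq_iff, hfib]
  rw [← Finset.sum_neg_distrib, ← Finset.sum_compl_add_sum T, Finset.sum_congr rfl
    fun i hi => if_neg (Finset.mem_compl.1 hi), Finset.sum_congr (s₁ := T) rfl
    fun i hi => if_pos hi]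
  simp

/-- The conditional law of the outputs at time `k` multiplied by `stepRatio`. -/
def tiltedProb (w : Fin M_a × Fin M_b) (k : Fin n) (v : Fin k → ∀ i, Option (Y i))
    (a : ∀ i, Option (Y i)) : ℝ :=
  C.stepProb W w k v a * C.stepRatio W T k (C.stepInput w k v) (T.restrict a)

lemma seqProb_tiltedProb (w : Fin M_a × Fin M_b) (y : Fin n → ∀ i, Option (Y i)) :
    seqProb (C.tiltedProb W T w) y =
      C.outputProb W w y * ∏ k, C.stepRatio W T k (C.input w y k) (T.restrict (y k)) :=
  Finset.prod_mul_distrib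

/-- The law of the outputs in `T` at time `k` given the past outputs in `T` that dominates
`tiltedProb`. -/
def cutProb (w : Fin M_a × Fin M_b) (k : Fin n) (v : Fin k → ∀ j : T, Option (Y j))
    (z : ∀ j : T, Option (Y j)) : ℝ :=
  if h : C.sender k ∈ T then
    W.marginal T (Function.update (fun _ => none) (C.sender k)
      (C.enc (C.sender k) k (localMessage (C.sender k) w) fun j => v j ⟨C.sender k, h⟩)) z
  else W.outputLaw T (C.sender k) (C.phaseInput W (C.sender k)) z

/-- Here `e` splits the message pair into a part `α` unknown in `T` and side information `β`. -/
lemma cutProb_congr {A B : Type*} (e : A × B ≃ Fin M_a × Fin M_b)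
    (he : ∀ i ∈ T, ∀ α α' β, localMessage i (e (α, β)) =
    localMessage i (e (α', β))) (α α' : A) (β : B) :
    C.cutProb W T (e (α, β)) = C.cutProb W T (e (α', β)) := by
  funext k v z
  unfold cutProb
  split_ifs with h
  · rw [he _ h α α']
  · rfl

variable [NeZero M_a] [NeZero M_b]

lemma tiltedProb_nonneg (w : Fin M_a × Fin M_b) (k : Fin n) (v : Fin k → ∀ i, Option (Y i))
    (a : ∀ i, Option (Y i)) : 0 ≤ C.tiltedProb W T w k v a :=
  mul_nonneg (W.prob_nonneg _ _) (W.cutRatio_nonneg T _ (C.phaseInput_mem W _) _ _)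

lemma cutProb_nonneg (w : Fin M_a × Fin M_b) (k : Fin n) (v : Fin k → ∀ j : T, Option (Y j))
    (z : ∀ j : T, Option (Y j)) : 0 ≤ C.cutProb W T w k v z := by
  unfold cutProb
  split_ifs
  exacts [W.marginal_nonneg T _ _, W.outputLaw_nonneg T _ (C.phaseInput_mem W _) _]

lemma sum_cutProb (w : Fin M_a × Fin M_b) (k : Fin n) (v : Fin k → ∀ j : T, Option (Y j)) :
    ∑ z, C.cutProb W T w k v z = 1 := by
  unfold cutProb
  split_ifs
  exacts [W.sum_marginal T _, W.sum_outputLaw T _ (C.phaseInput_mem W _)]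

open Classical in
-- The marginal cancels against the denominator of the ratio. Only an inequality holds, since the
-- tilted law loses the mass that the reference law puts where the marginal vanishes.
lemma sum_tiltedProb_le (w : Fin M_a × Fin M_b) (k : Fin n) (v : Fin k → ∀ i, Option (Y i))
    (z : ∀ j : T, Option (Y j)) :
    (∑ a, if T.restrict a = z then C.tiltedProb W T w k v a else 0) ≤
      C.cutProb W T w k (T.restrict ∘ v) z := by
  have h1 : (∑ a, if T.restrict a = z then C.tiltedProb W T w k v a else 0) =
      W.marginal T (C.stepInput w k v) z * C.stepRatio W T k (C.stepInput w k v) z := by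
    rw [Channel.marginal, Finset.sum_mul]
    refine Finset.sum_congr rfl fun a _ => ?_
    split_ifs with h
    · rw [← h]; rfl
    · simp
  rw [h1]
  unfold stepRatio Channel.cutRatio cutProb
  split_ifs with h
  · rw [mul_one, stepInput_eq_update]
    exact le_rfl
  · rcases eq_or_ne (W.marginal T (C.stepInput w k v) z) 0 with h0 | h0
    · rw [h0, zero_mul]
      exact W.outputLaw_nonneg T _ (C.phaseInput_mem W _) _
    · rw [mul_div_cancel₀ _ h0]

lemma sum_seqProb_tiltedProb_le (w : Fin M_a × Fin M_b)
    (g : (Fin n → ∀ j : T, Option (Y j)) → ℝ) (hg : ∀ z, 0 ≤ g z) :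
    ∑ y, seqProb (C.tiltedProb W T w) y * g (T.restrict ∘ y) ≤
      ∑ z, seqProb (C.cutProb W T w) z * g z :=
  sum_seqProb_comp_le T.restrict (C.tiltedProb W T w) (C.cutProb W T w)
    (C.tiltedProb_nonneg W T w) (C.cutProb_nonneg W T w)
    (fun k v z => by convert C.sum_tiltedProb_le W T w k v z) g hg

lemma sum_seqProb_tiltedProb_le_one (w : Fin M_a × Fin M_b) :
    ∑ y, seqProb (C.tiltedProb W T w) y ≤ 1 := by
  have h := C.sum_seqProb_tiltedProb_le W T w (fun _ => 1) fun _ => zero_le_one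
  simp only [mul_one] at h
  exact h.trans (sum_seqProb_eq_one _ (C.sum_cutProb W T w)).le

/-! ### Decoding across a cut -/

section Decoding

variable {A B : Type*} (e : A × B ≃ Fin M_a × Fin M_b)
  (dec : B → (Fin n → ∀ j : T, Option (Y j)) → Option A)

open Classical in
/-- The indicator of the event that the outputs in `T` and the side information in `B` determine
the message in `A`. -/
def success (w : Fin M_a × Fin M_b) (y : Fin n → ∀ i, Option (Y i)) : ℝ :=
  if dec (e.symm w).2 (T.restrict ∘ y) = some (e.symm w).1 then 1 else 0

variable [Fintype A] [Fintype B]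

/-- For fixed side information the dominating law is the same for all `α`, and the decoder names at
most one `α`. So the successes sum to at most one for each `β`. -/
lemma sum_seqProb_tiltedProb_success_le (he : ∀ i ∈ T, ∀ α α' β, localMessage i (e (α, β)) =
    localMessage i (e (α', β))) :
    ∑ w, ∑ y, seqProb (C.tiltedProb W T w) y * success T e dec w y ≤ Fintype.card B := by
  classical
  rw [← e.sum_comp, Fintype.sum_prod_type_right]
  rw [← Finset.card_univ, Finset.cast_card]
  refine Finset.sum_le_sum fun β _ => ?_
  rcases isEmpty_or_nonempty A with hA | ⟨⟨α₀⟩⟩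
  · simp
  calc ∑ α, ∑ y, seqProb (C.tiltedProb W T (e (α, β))) y * success T e dec (e (α, β)) y
      ≤ ∑ α, ∑ z, seqProb (C.cutProb W T (e (α₀, β))) z *
          (if dec β z = some α then 1 else 0) := by
        refine Finset.sum_le_sum fun α _ => ?_
        rw [C.cutProb_congr W T e he α₀ α β]
        refine le_trans (le_of_eq ?_) (C.sum_seqProb_tiltedProb_le W T (e (α, β))
          (fun z => if dec β z = some α then 1 else 0) fun z => by split_ifs <;> simp)
        simp [success]
    _ = ∑ z, seqProb (C.cutProb W T (e (α₀, β))) z *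
          ∑ α, (if dec β z = some α then 1 else 0) := by
        rw [Finset.sum_comm]
        simp_rw [Finset.mul_sum]
    _ ≤ ∑ z, seqProb (C.cutProb W T (e (α₀, β))) z := by
        refine Finset.sum_le_sum fun z _ => mul_le_of_le_one_right
          (seqProb_nonneg (C.cutProb_nonneg W T _) z) ?_
        rcases h : dec β z with _ | α
        · simp
        · simp
    _ = 1 := sum_seqProb_eq_one _ (C.sum_cutProb W T _)

/-- The cut-set bound at finite block length: nodes in `T` decode a message of which only nodes
outside `T` are informed. -/
lemma expect_success_mul_log_card_le (he : ∀ i ∈ T, ∀ α α' β, localMessage i (e (α, β)) =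
    localMessage i (e (α', β))) :
    C.expect W (success T e dec) * Real.log (Fintype.card A) ≤
      ∑ i ∈ Tᶜ, (Finset.univ.filter fun k => C.phase k = Fin.rev i).card *
        (W.phaseInfo i T (C.phaseInput W i) * Real.log 2) + Real.log 2 := by
  classical
  have ha : (0 : ℝ) < M_a := Nat.cast_pos.2 (NeZero.pos _)
  have hb : (0 : ℝ) < M_b := Nat.cast_pos.2 (NeZero.pos _)
  have hcard : (Fintype.card A : ℝ) * Fintype.card B = M_a * M_b := by
    have h := Fintype.card_congr e
    simp only [Fintype.card_prod, Fintype.card_fin] at h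
    exact_mod_cast h
  have hA : (0 : ℝ) < Fintype.card A := by
    rcases (Nat.cast_nonneg (α := ℝ) (Fintype.card A)).eq_or_lt with h | h
    · rw [← h, zero_mul] at hcard
      exact absurd hcard (mul_pos ha hb).ne
    · exact h
  let ρ : Fin M_a × Fin M_b → (Fin n → ∀ i, Option (Y i)) → ℝ := fun w y =>
    ∏ k, C.stepRatio W T k (C.input w y k) (T.restrict (y k))
  -- The weight is the number of messages on success and `1` on failure, so that its logarithm is
  -- `success` times the log-cardinality.
  let σ : Fin M_a × Fin M_b → (Fin n → ∀ i, Option (Y i)) → ℝ := fun w y =>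
    if dec (e.symm w).2 (T.restrict ∘ y) = some (e.symm w).1 then (Fintype.card A : ℝ) else 1
  have hσ : ∀ w y, 0 < σ w y := fun w y => by dsimp only [σ]; split_ifs <;> simp [hA]
  have hρ0 : ∀ w y, 0 ≤ ρ w y := fun w y => Finset.prod_nonneg fun k _ =>
    W.cutRatio_nonneg T _ (C.phaseInput_mem W _) _ _
  have hρ : ∀ w y, 0 < C.outputProb W w y → ∀ k,
    0 < C.stepRatio W T k (C.input w y k) (T.restrict (y k)) :=
    fun w y h k => C.stepRatio_pos W T h k
  let P : (Fin M_a × Fin M_b) × (Fin n → ∀ i, Option (Y i)) → ℝ := fun ω =>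
    C.outputProb W ω.1 ω.2 / (M_a * M_b)
  have hexp : ∀ f : Fin M_a × Fin M_b → (Fin n → ∀ i, Option (Y i)) → ℝ,
      ∑ ω, P ω * f ω.1 ω.2 = C.expect W f := fun f => by
    rw [Fintype.sum_prod_type, expect, Finset.sum_div]
    refine Finset.sum_congr rfl fun w _ => ?_
    rw [Finset.sum_div]
    exact Finset.sum_congr rfl fun y _ => by dsimp only [P]; ring
  have hP1 : ∀ ω, 0 < P ω → 0 < C.outputProb W ω.1 ω.2 := fun ω h =>
    (div_pos_iff_of_pos_right (mul_pos ha hb)).1 h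
  -- The mean of `σ * ρ` is at most 2: the success part contributes at most `card A * card B / (M_a
  -- * M_b) = 1`, and the term `1` bounding `σ` on failure contributes at most one more. This is the
  -- source of the additive `log 2`.
  have key := sum_mul_log_nonpos P (fun ω => σ ω.1 ω.2 * ρ ω.1 ω.2 / 2)
    (fun ω => div_nonneg (C.outputProb_nonneg W _ _) (mul_pos ha hb).le)
    (by simpa [C.expect_one W] using hexp fun _ _ => 1)
    (fun ω hω => by
      have := Finset.prod_pos fun k (_ : k ∈ Finset.univ) => hρ ω.1 ω.2 (hP1 ω hω) k
      have := hσ ω.1 ω.2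
      positivity)
    ?_
  · have hlog : ∀ ω, P ω * Real.log (σ ω.1 ω.2 * ρ ω.1 ω.2 / 2) =
        P ω * (success T e dec ω.1 ω.2 * Real.log (Fintype.card A)) +
        P ω * (∑ k, Real.log (C.stepRatio W T k (C.input ω.1 ω.2 k) (T.restrict (ω.2 k)))) -
        P ω * Real.log 2 := fun ω => by
      rcases (div_nonneg (C.outputProb_nonneg W ω.1 ω.2) (mul_pos ha hb).le).eq_or_lt with h | h
      · have : P ω = 0 := h.symm
        simp [this]
      · have hk := hρ ω.1 ω.2 (hP1 ω h)
        have hk' := Finset.prod_pos fun k (_ : k ∈ Finset.univ) => hk k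
        have h1 : Real.log (σ ω.1 ω.2) = success T e dec ω.1 ω.2 * Real.log (Fintype.card A) := by
          dsimp only [σ, success]
          split_ifs <;> simp
        rw [Real.log_div (mul_pos (hσ _ _) hk').ne' two_ne_zero,
          Real.log_mul (hσ _ _).ne' hk'.ne', Real.log_prod fun k _ => (hk k).ne', h1]
        ring
    simp_rw [hlog] at key
    rw [Finset.sum_sub_distrib, Finset.sum_add_distrib,
      hexp fun w y => success T e dec w y * Real.log (Fintype.card A),
      hexp fun w y => ∑ k, Real.log (C.stepRatio W T k (C.input w y k) (T.restrict (y k))),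
      hexp fun _ _ => Real.log 2, C.expect_mul_const W, C.expect_sum W,
      C.sum_expect_log_stepRatio W T] at key
    have h2 := C.expect_mul_const W (fun _ _ => 1) (Real.log 2)
    simp only [one_mul, C.expect_one W] at h2
    rw [h2] at key
    linarith
  · rw [hexp fun w y => σ w y * ρ w y / 2]
    have hle : ∑ w, ∑ y, C.outputProb W w y * (σ w y * ρ w y / 2) ≤
        (Fintype.card A * ∑ w, ∑ y, seqProb (C.tiltedProb W T w) y * success T e dec w y +
          ∑ w, ∑ y, seqProb (C.tiltedProb W T w) y) / 2 := by
      rw [Finset.mul_sum, ← Finset.sum_add_distrib, Finset.sum_div]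
      refine Finset.sum_le_sum fun w _ => ?_
      rw [Finset.mul_sum, ← Finset.sum_add_distrib, Finset.sum_div]
      refine Finset.sum_le_sum fun y _ => ?_
      rw [seqProb_tiltedProb]
      have h0 := mul_nonneg (C.outputProb_nonneg W w y) (hρ0 w y)
      have h1 : σ w y ≤ Fintype.card A * success T e dec w y + 1 := by
        dsimp only [σ, success]
        split_ifs <;> simp
      have := mul_le_mul_of_nonneg_left h1 h0
      dsimp only [ρ] at this ⊢
      linarith
    have h1 := C.sum_seqProb_tiltedProb_success_le W T e dec he
    have h2 : ∑ w, ∑ y, seqProb (C.tiltedProb W T w) y ≤ M_a * M_b :=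
      (Finset.sum_le_sum fun w _ => C.sum_seqProb_tiltedProb_le_one W T w).trans
        (by simp)
    have h3 := mul_le_mul_of_nonneg_left h1 hA.le
    rw [expect, div_le_one (mul_pos ha hb)]
    linarith

end Decoding

end Code

end

section

variable {m : ℕ} {X : Fin (m + 2) → Type*} {Y : Fin (m + 2) → Type*}
  [∀ i, Fintype (Y i)]

/-! ### The finite-length bounds in the two directions -/

namespace Code

variable {n M_a M_b : ℕ} [NeZero M_a] [NeZero M_b] (C : Code X Y n M_a M_b) (W : Channel X Y)

lemma expect_indicator_eq_one_sub (p : Fin M_a × Fin M_b → (Fin n → ∀ i, Option (Y i)) → Prop)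
    [∀ w y, Decidable (p w y)] :
    C.expect W (fun w y => if p w y then 1 else 0) =
      1 - (∑ w, ∑ y, if p w y then 0 else C.outputProb W w y) / (M_a * M_b) := by
  have h1 : 1 = (∑ w, ∑ y, C.outputProb W w y * 1) / ((M_a : ℝ) * M_b) := (C.expect_one W).symm
  refine Eq.trans ?_ (congrArg (fun t => t - _) h1.symm)
  rw [expect, ← sub_div, ← Finset.sum_sub_distrib]
  congr 1
  refine Finset.sum_congr rfl fun w _ => ?_
  rw [← Finset.sum_sub_distrib]
  refine Finset.sum_congr rfl fun y _ => ?_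
  split_ifs <;> simp

variable [∀ i, Fintype (X i)] [∀ i, Nonempty (X i)]

/-- The cut has `b` and the relays outside `S` as receivers; none of them knows `w_a`, and the side
information is `w_b`. -/
lemma one_sub_errorProb_ab_mul_log_le {S : Finset (Fin (m + 2))} (hS : S ⊆ relays m) :
    (1 - C.errorProb_ab W) * Real.log M_a ≤
      ∑ i ∈ insert 0 S, (Finset.univ.filter fun k => C.phase k = Fin.rev i).card *
        (W.phaseInfo i (insert (Fin.last (m + 1)) (relays m \ S)) (C.phaseInput W i) *
          Real.log 2) + Real.log 2 := by
  classical
  have hT : (insert (Fin.last (m + 1)) (relays m \ S))ᶜ = insert 0 S := by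
    ext i
    have h0 : (0 : Fin (m + 2)) ≠ Fin.last (m + 1) := Fin.last_pos.ne
    have hi := @hS i
    simp only [relays, Finset.mem_compl, Finset.mem_insert, Finset.mem_sdiff,
      Finset.mem_singleton] at hi ⊢
    grind
  have h := C.expect_success_mul_log_card_le W (insert (Fin.last (m + 1)) (relays m \ S))
    (Equiv.refl _) (fun β z => C.dec_b β fun k => z k ⟨Fin.last (m + 1), by simp⟩)
    (fun i hi α α' β => by
      have h0 : i ≠ 0 := by
        rintro rfl
        simp [relays, Fin.last_pos.ne] at hi
      simp [localMessage, h0])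
  rw [hT, Fintype.card_fin] at h
  rw [errorProb_ab, ← C.expect_indicator_eq_one_sub W]
  refine le_of_eq_of_le (congrArg (· * _) (congrArg _ ?_)) h
  funext w y
  unfold success
  convert rfl <;> rfl

lemma one_sub_errorProb_ba_mul_log_le {S : Finset (Fin (m + 2))} (hS : S ⊆ relays m) :
    (1 - C.errorProb_ba W) * Real.log M_b ≤
      ∑ i ∈ insert (Fin.last (m + 1)) S,
        (Finset.univ.filter fun k => C.phase k = Fin.rev i).card *
        (W.phaseInfo i (insert 0 (relays m \ S)) (C.phaseInput W i) * Real.log 2) +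
          Real.log 2 := by
  classical
  have hT : (insert 0 (relays m \ S))ᶜ = insert (Fin.last (m + 1)) S := by
    ext i
    have h0 : (0 : Fin (m + 2)) ≠ Fin.last (m + 1) := Fin.last_pos.ne
    have hi := @hS i
    simp only [relays, Finset.mem_compl, Finset.mem_insert, Finset.mem_sdiff,
      Finset.mem_singleton] at hi ⊢
    grind
  have h := C.expect_success_mul_log_card_le W (insert 0 (relays m \ S))
    -- Swapping the messages makes `w_b` the unknown part and `w_a` the side information.
    (Equiv.prodComm _ _) (fun β z => C.dec_a β fun k => z k ⟨0, by simp⟩)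
    (fun i hi α α' β => by
      have h0 : i ≠ Fin.last (m + 1) := by
        rintro rfl
        simp [relays, Fin.last_pos.ne'] at hi
      simp [localMessage, h0])
  rw [hT, Fintype.card_fin] at h
  rw [errorProb_ba, ← C.expect_indicator_eq_one_sub W]
  refine le_of_eq_of_le (congrArg (· * _) (congrArg _ ?_)) h
  funext w y
  unfold success
  convert rfl <;> rfl


end Code

/-! ### Compactness and the passage to the limit -/

variable [∀ i, Fintype (X i)]

/-- Projection along a compact factor is a closed map. A single witness `p` for all `j` thus
survives limits. -/
lemma isClosed_exists_le {Q E ι : Type*} [TopologicalSpace Q] [TopologicalSpace E] {K : Set E}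
    (hK : IsCompact K) (a : ι → Q → ℝ) (ha : ∀ j, Continuous (a j)) (Φ : ι → Q → E → ℝ)
    (hΦ : ∀ j, Continuous fun q : Q × K => Φ j q.1 q.2) :
    IsClosed {q | ∃ p ∈ K, ∀ j, a j q ≤ Φ j q p} := by
  have : CompactSpace K := isCompact_iff_compactSpace.1 hK
  have h : IsClosed {q : Q × K | ∀ j, a j q.1 ≤ Φ j q.1 q.2} := by
    simp only [Set.ofPred_forall]
    exact isClosed_iInter fun j => isClosed_le ((ha j).comp continuous_fst) (hΦ j)
  convert isClosedMap_fst_of_compactSpace _ h using 1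
  ext q
  simp

lemma Channel.continuousOn_phaseInfo (W : Channel X Y) (i : Fin (m + 2))
    (T : Finset (Fin (m + 2))) : ContinuousOn (W.phaseInfo i T) (stdSimplex ℝ (X i)) := by
  have hf : Continuous fun (p : X i → ℝ) (x : X i) (z : ∀ j : T, Option (Y j)) =>
      p x * W.phaseProb i T x z :=
    continuous_pi fun x => continuous_pi fun z => (continuous_apply x).mul continuous_const
  exact continuousOn_mutualInfo.comp hf.continuousOn
    fun p hp x z => mul_nonneg (hp.1 x) (W.marginal_nonneg T _ z)

/-- The cut-set bound for the cut `S` with phase durations `δ`, source `s` and destination `d`. -/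
def Channel.cutValue (W : Channel X Y) (s d : Fin (m + 2)) (S : Finset (Fin (m + 2)))
    (δ : Fin (m + 2) → ℝ) (p : ∀ i, X i → ℝ) : ℝ :=
  ∑ i ∈ insert s S, δ (Fin.rev i) * W.phaseInfo i (insert d (relays m \ S)) (p i)

/-- The rate pairs and phase durations that satisfy all cut-set bounds with common input
distributions. -/
def Channel.outerRegion (W : Channel X Y) : Set ((ℝ × ℝ) × (Fin (m + 2) → ℝ)) :=
  {q | ∃ p ∈ Set.univ.pi fun i => stdSimplex ℝ (X i), ∀ S : (relays m).powerset,
    q.1.1 ≤ W.cutValue 0 (Fin.last (m + 1)) S q.2 p ∧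
    q.1.2 ≤ W.cutValue (Fin.last (m + 1)) 0 S q.2 p}

lemma Channel.isClosed_outerRegion (W : Channel X Y) : IsClosed W.outerRegion := by
  have hc : ∀ s d S, Continuous fun q : ((ℝ × ℝ) × (Fin (m + 2) → ℝ)) ×
      (Set.univ.pi fun i => stdSimplex ℝ (X i)) => W.cutValue s d S q.1.2 q.2 := by
    intro s d S
    refine continuous_finsetSum _ fun i _ => Continuous.mul (by fun_prop) ?_
    refine (W.continuousOn_phaseInfo i _).comp_continuous
      (f := fun q : ((ℝ × ℝ) × (Fin (m + 2) → ℝ)) ×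
        (Set.univ.pi fun i => stdSimplex ℝ (X i)) => (q.2 : ∀ i, X i → ℝ) i)
      ((continuous_apply i).comp (continuous_subtype_val.comp continuous_snd))
      fun q => q.2.2 i (Set.mem_univ i)
  have h := isClosed_exists_le (isCompact_univ_pi fun i => isCompact_stdSimplex ℝ (X i))
    -- The Boolean merges the bounds on the two rates into one family with a common witness.
    (ι := (relays m).powerset × Bool)
    (fun j (q : (ℝ × ℝ) × (Fin (m + 2) → ℝ)) => if j.2 then q.1.1 else q.1.2)
    (fun j => by rcases j with ⟨S, _ | _⟩ <;> simp only [if_true, if_false, Bool.false_eq_true] <;>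
      fun_prop)
    (fun j q p => if j.2 then W.cutValue 0 (Fin.last (m + 1)) j.1 q.2 p
      else W.cutValue (Fin.last (m + 1)) 0 j.1 q.2 p)
    (fun j => by
      rcases j with ⟨S, _ | _⟩
      · simpa using hc (Fin.last (m + 1)) 0 S
      · simpa using hc 0 (Fin.last (m + 1)) S)
  convert h using 1
  ext q
  simp [outerRegion, and_comm]

/-- For `x ≥ 1` the floor of `x` is at least `x / 2`, so rounding costs at most one bit. -/
lemma mul_log_two_sub_le_log_floor {R : ℝ} (hR : 0 ≤ R) (n : ℕ) :
    (n * R - 1) * Real.log 2 ≤ Real.log ⌊(2 : ℝ) ^ (n * R)⌋₊ := by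
  have h1 : (1 : ℝ) ≤ (2 : ℝ) ^ (n * R) := Real.one_le_rpow one_le_two (by positivity)
  have h2 : (1 : ℝ) ≤ ⌊(2 : ℝ) ^ (n * R)⌋₊ := by
    exact_mod_cast Nat.le_floor (by simpa using h1)
  have h3 := Nat.lt_floor_add_one ((2 : ℝ) ^ (n * R))
  rw [← Real.log_rpow two_pos]
  refine Real.log_le_log (by positivity) ?_
  rw [Real.rpow_sub two_pos, Real.rpow_one]
  linarith

lemma floor_two_rpow_ne_zero {R : ℝ} (hR : 0 ≤ R) (n : ℕ) : ⌊(2 : ℝ) ^ (n * R)⌋₊ ≠ 0 :=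
  (Nat.floor_pos.2 (Real.one_le_rpow one_le_two (by positivity))).ne'

lemma tendsto_one_sub_mul {ε : ℕ → ℝ} (hε : Tendsto ε atTop (𝓝 0)) (R : ℝ) :
    Tendsto (fun n : ℕ => (1 - ε n) * (R - 1 / n) - 1 / n) atTop (𝓝 R) := by
  have h := tendsto_one_div_atTop_nhds_zero_nat (𝕜 := ℝ)
  simpa using ((tendsto_const_nhds (x := (1 : ℝ))).sub hε).mul
    ((tendsto_const_nhds (x := R)).sub h) |>.sub h

/-- Normalization of the bound at finite block length. -/
lemma rate_le_of_log_le {ι : Type*} {s : Finset ι} {c I : ι → ℝ} {n : ℕ} (hn : n ≠ 0) {R ε : ℝ}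
    (hR : 0 ≤ R) (hε : 0 ≤ 1 - ε)
    (h : (1 - ε) * Real.log ⌊(2 : ℝ) ^ (n * R)⌋₊ ≤
      ∑ i ∈ s, c i * (I i * Real.log 2) + Real.log 2) :
    (1 - ε) * (R - 1 / n) - 1 / n ≤ ∑ i ∈ s, c i / n * I i := by
  have hn' : (0 : ℝ) < n := Nat.cast_pos.2 (Nat.pos_of_ne_zero hn)
  have h2 : 0 < Real.log 2 := Real.log_pos one_lt_two
  have h3 := (mul_le_mul_of_nonneg_left (mul_log_two_sub_le_log_floor hR n) hε).trans h
  simp_rw [← mul_assoc] at h3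
  rw [← Finset.sum_mul] at h3
  have h4 : (1 - ε) * (n * R - 1) ≤ ∑ i ∈ s, c i * I i + 1 := by
    refine le_of_mul_le_mul_right ?_ h2
    linarith
  have h5 : ∑ i ∈ s, c i / n * I i = (∑ i ∈ s, c i * I i) / n := by
    rw [Finset.sum_div]
    exact Finset.sum_congr rfl fun i _ => by ring
  rw [h5, le_div_iff₀ hn']
  have h6 : ((1 - ε) * (R - 1 / n) - 1 / n) * n = (1 - ε) * (n * R - 1) - 1 := by
    field_simp
  linarith

variable [∀ i, Nonempty (X i)]

/-- Each code of positive length puts slightly reduced rates, paired with its own actual durations,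
in the region; these points converge to the claimed one. This is why durations are coordinates of
the region. -/
lemma Channel.mem_outerRegion_of_isAchievable (W : Channel X Y) {Δ : Fin (m + 2) → ℝ}
    {R_a R_b : ℝ} (h : W.IsAchievable Δ R_a R_b) : ((R_a, R_b), Δ) ∈ W.outerRegion := by
  obtain ⟨ha, hb, C, hC, hab, hba⟩ := h
  refine W.isClosed_outerRegion.mem_of_tendsto (((tendsto_one_sub_mul hab R_a).prodMk_nhds
    (tendsto_one_sub_mul hba R_b)).prodMk_nhds (tendsto_pi_nhds.2 hC)) ?_
  filter_upwards [eventually_ne_atTop 0] with n hn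
  have : NeZero ⌊(2 : ℝ) ^ (n * R_a)⌋₊ := ⟨floor_two_rpow_ne_zero ha n⟩
  have : NeZero ⌊(2 : ℝ) ^ (n * R_b)⌋₊ := ⟨floor_two_rpow_ne_zero hb n⟩
  refine ⟨(C n).phaseInput W, fun i _ => (C n).phaseInput_mem W i, fun S => ⟨?_, ?_⟩⟩
  · refine rate_le_of_log_le hn ha ?_
      ((C n).one_sub_errorProb_ab_mul_log_le W (Finset.mem_powerset.1 S.2))
    rw [Code.errorProb_ab, ← Code.expect_indicator_eq_one_sub]
    exact (C n).expect_nonneg W fun w y => by split_ifs <;> simp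
  · refine rate_le_of_log_le hn hb ?_
      ((C n).one_sub_errorProb_ba_mul_log_le W (Finset.mem_powerset.1 S.2))
    rw [Code.errorProb_ba, ← Code.expect_indicator_eq_one_sub]
    exact (C n).expect_nonneg W fun w y => by split_ifs <;> simp

end

end HalfDuplexNetwork

end

theorem mainTheorem5 {m : ℕ} (hm : 1 < m)
    (X : Fin (m + 2) → Type*) (Y : Fin (m + 2) → Type*)
    [∀ i, Fintype (X i)] [∀ i, Nonempty (X i)] [∀ i, Fintype (Y i)]
    (W : HalfDuplexNetwork.Channel X Y)
    (Δ : Fin (m + 2) → ℝ) (hΔ : Δ ∈ stdSimplex ℝ (Fin (m + 2))) :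
    W.capacityRegion Δ ⊆
      {R : ℝ × ℝ | ∃ p : ∀ i, X i → ℝ, (∀ i, p i ∈ stdSimplex ℝ (X i)) ∧
        R.1 ≤ (HalfDuplexNetwork.relays m).powerset.inf' (Finset.powerset_nonempty _)
          (fun S => ∑ i ∈ insert 0 S,
            Δ (Fin.rev i) *
              W.phaseInfo i (insert (Fin.last (m + 1)) (HalfDuplexNetwork.relays m \ S)) (p i)) ∧
        R.2 ≤ (HalfDuplexNetwork.relays m).powerset.inf' (Finset.powerset_nonempty _)
          (fun S => ∑ i ∈ insert (Fin.last (m + 1)) S,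
            Δ (Fin.rev i) *
              W.phaseInfo i (insert 0 (HalfDuplexNetwork.relays m \ S)) (p i))} := by
  -- The slice of the closed region at fixed `Δ` is closed, so it contains the closure of the
  -- achievable pairs.
  have h : W.capacityRegion Δ ⊆ (fun R => (R, Δ)) ⁻¹' W.outerRegion :=
    closure_minimal (fun R hR => W.mem_outerRegion_of_isAchievable hR)
      (W.isClosed_outerRegion.preimage (by fun_prop))
  intro R hR
  obtain ⟨p, hp, hS⟩ := h hR
  refine ⟨p, fun i => hp i (Set.mem_univ i), ?_, ?_⟩
  · exact Finset.le_inf' _ _ fun S hS' => (hS ⟨S, hS'⟩).1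
  · exact Finset.le_inf' _ _ fun S hS' => (hS ⟨S, hS'⟩).2
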